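/- Let $\alpha\in(0,1)$, $\varphi_0>0$, $C>0$, $M>0$, and let $f:[\varphi_0,\infty)\to(0,\infty)$ be twice differentiable (one-sided at $\varphi_0$) with $$\lim_{\varphi\to\infty}\frac{f(\varphi)}{C\varphi^{-\alpha}}=1,\qquad \lim_{\varphi\to\infty}\frac{f'(\varphi)}{-\alpha C\varphi^{-\alpha-1}}=1,\qquad |f''(\varphi)|\le M\varphi^{-\alpha}\ \text{ for all }\varphi\ge\varphi_0 .$$ Let $\Gamma=\{(f(\varphi)\cos\varphi,f(\varphi)\sin\varphi):\varphi\ge\varphi_0\}\subset\mathbb R^2$ be the spiral $r=f(\varphi)$, and let $\Gamma'\subset\mathbb R^2$ be the spiral given in the same way by $\rho=\frac{f(\varphi)}{f(\varphi)^2+1}$, $\varphi\ge\varphi_0$. For a nonempty bounded $A\subset\mathbb R^n$ with open Euclidean $\varepsilon$-neighbourhood $A_\varepsilon$ and Lebesgue measure $|\cdot|$, let the upper and lower $s$-dimensional Minkowski contents $\mathcal M^{*s}(A),\mathcal M^s_*(A)\in[0,\infty]$ be the $\limsup$ and $\liminf$ of $|A_\varepsilon|/\varepsilon^{n-s}$ as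 $\varepsilon\to0^+$, and let the upper and lower box dimensions of $A$ be $\inf\{s>0:\mathcal M^{*s}(A)=0\}$ and $\inf\{s>0:\mathcal M^{s}_*(A)=0\}$; a common value of the two contents (dimensions) is called the $s$-dimensional Minkowski content (the box dimension) of $A$. Then $\Gamma$ and $\Gamma'$ both have box dimension $d=\frac{2}{1+\alpha}$; moreover, the $d$-dimensional Minkowski contents of $\Gamma$ and $\Gamma'$ exist, are positive and finite, and are equal. -/

import Mathlib

open Filter Topology MeasureTheory
open scoped ENNReal

noncomputable section

/-- The upper `s`-dimensional Minkowski content of `A ⊆ ℝⁿ`: the upper limit of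
`|A_ε| / ε ^ (n - s)` as `ε → 0⁺`, where `A_ε` is the open Euclidean `ε`-neighbourhood of `A` and
`|·|` is `n`-dimensional Lebesgue measure. It takes values in `[0, ∞]`. -/
def upperMinkowskiContent {n : ℕ} (s : ℝ) (A : Set (EuclideanSpace ℝ (Fin n))) : ℝ≥0∞ :=
  limsup (fun ε : ℝ => volume (Metric.thickening ε A) / ENNReal.ofReal (ε ^ ((n : ℝ) - s)))
    (𝓝[>] (0 : ℝ))

/-- The lower `s`-dimensional Minkowski content of `A ⊆ ℝⁿ`. -/
def lowerMinkowskiContent {n : ℕ} (s : ℝ) (A : Set (EuclideanSpace ℝ (Fin n))) : ℝ≥0∞ :=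
  liminf (fun ε : ℝ => volume (Metric.thickening ε A) / ENNReal.ofReal (ε ^ ((n : ℝ) - s)))
    (𝓝[>] (0 : ℝ))

/-- The upper box dimension of a nonempty bounded set `A ⊆ ℝⁿ`. For bounded `A` the set of
exponents contains every `s > n`, so the real infimum is a genuine one. -/
def upperBoxDim {n : ℕ} (A : Set (EuclideanSpace ℝ (Fin n))) : ℝ :=
  sInf {s : ℝ | 0 < s ∧ upperMinkowskiContent s A = 0}

/-- The lower box dimension of a nonempty bounded set `A ⊆ ℝⁿ`. -/
def lowerBoxDim {n : ℕ} (A : Set (EuclideanSpace ℝ (Fin n))) : ℝ :=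
  sInf {s : ℝ | 0 < s ∧ lowerMinkowskiContent s A = 0}

/-- The box dimension of `A` exists and equals `d`. -/
def HasBoxDim {n : ℕ} (A : Set (EuclideanSpace ℝ (Fin n))) (d : ℝ) : Prop :=
  lowerBoxDim A = d ∧ upperBoxDim A = d

/-- The `s`-dimensional Minkowski content of `A` exists and equals `m`. -/
def HasMinkowskiContent {n : ℕ} (s : ℝ) (A : Set (EuclideanSpace ℝ (Fin n))) (m : ℝ≥0∞) : Prop :=
  lowerMinkowskiContent s A = m ∧ upperMinkowskiContent s A = m

/-- The planar curve given in polar coordinates by `r = f φ`, `φ ≥ φ₀`. -/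
def spiral (f : ℝ → ℝ) (φ₀ : ℝ) : Set (EuclideanSpace ℝ (Fin 2)) :=
  {x | ∃ φ : ℝ, φ₀ ≤ φ ∧ x = !₂[f φ * Real.cos φ, f φ * Real.sin φ]}

end

/-! Write `ε = X ^ (-(1 + α))`. At angle `φ`, successive turns of the spiral are about `2παC φ ^ (-α
- 1)` apart, and this equals `2ε` near `φ = A X` with `A = (παC) ^ (1 / (1 + α))`. Beyond that angle
the neighbourhoods of the turns merge into a disc of radius about `C (A X) ^ (-α)`. Before it they
are disjoint bands of total area about `2ε ∫ f ≈ 2ε C (A X) ^ (1 - α) / (1 - α)`. Both areas are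
constants times `X ^ (-2α) = ε ^ (2 - d)`, and the two constants are the summands of `spiralContent
α C`. A positive finite content in dimension `d` forces box dimension `d` (`hasBoxDim_of_tendsto`).

The bands are modelled by radial strips `|r - f φ| < ε`, whose area comes from polar coordinates. A
radial strip lies in the neighbourhood; conversely, since `f' / f` tends to zero, the neighbourhood
lies in a disc together with a strip wider by a factor `1 + δ`. This gives
`le_volume_thickening_spiral` and `volume_thickening_spiral_le`. The outer arc, where the
asymptotics are not yet effective, costs `O(ε)`, negligible because `d > 1`.

The limit depends on `f` only through `α` and `C`. Since `f → 0`, the function `f / (f ^ 2 + 1)` and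
its derivative have the same asymptotics as `f` and `f'`, so the contents agree. -/

/-! ### Distances and angles in polar coordinates -/

/-- The point of the Euclidean plane with polar coordinates `(r, φ)`. -/
noncomputable def polarPoint (r φ : ℝ) : EuclideanSpace ℝ (Fin 2) := !₂[r * Real.cos φ, r * Real.sin φ]

lemma dist_polarPoint_sq (r s θ φ : ℝ) :
    dist (polarPoint r θ) (polarPoint s φ) ^ 2
      = (r - s) ^ 2 + 2 * r * s * (1 - Real.cos (θ - φ)) := by
  rw [EuclideanSpace.dist_eq, Real.sq_sqrt (by positivity), Fin.sum_univ_two, Real.dist_eq,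
    Real.dist_eq, sq_abs, sq_abs, Real.cos_sub]
  simp only [polarPoint, Fin.isValue, PiLp.toLp_apply, Matrix.cons_val_zero, Matrix.cons_val_one]
  linear_combination r ^ 2 * Real.sin_sq_add_cos_sq θ + s ^ 2 * Real.sin_sq_add_cos_sq φ

lemma dist_polarPoint_same_angle (r s φ : ℝ) :
    dist (polarPoint r φ) (polarPoint s φ) = |r - s| := by
  rw [← Real.sqrt_sq (dist_nonneg (x := polarPoint r φ)), dist_polarPoint_sq, sub_self,
    Real.cos_zero, sub_self, mul_zero, add_zero, Real.sqrt_sq_eq_abs]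

lemma norm_polarPoint (r φ : ℝ) : ‖polarPoint r φ‖ = |r| := by
  have h : polarPoint 0 φ = 0 := by
    ext i; fin_cases i <;> simp [polarPoint]
  rw [← dist_zero_right, ← h, dist_polarPoint_same_angle, sub_zero]

lemma abs_sub_le_dist_polarPoint {r s : ℝ} (hr : 0 ≤ r) (hs : 0 ≤ s) (θ φ : ℝ) :
    |r - s| ≤ dist (polarPoint r θ) (polarPoint s φ) := by
  refine abs_le_of_sq_le_sq ?_ dist_nonneg
  rw [dist_polarPoint_sq]
  have := Real.cos_le_one (θ - φ)
  have : 0 ≤ 2 * r * s * (1 - Real.cos (θ - φ)) := mul_nonneg (by positivity) (by linarith)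
  linarith

lemma dist_polarPoint_same_radius_le (s θ φ : ℝ) :
    dist (polarPoint s θ) (polarPoint s φ) ≤ |s| * |θ - φ| := by
  refine le_of_sq_le_sq ?_ (by positivity)
  rw [dist_polarPoint_sq, mul_pow, sq_abs, sq_abs]
  have := Real.one_sub_sq_div_two_le_cos (x := θ - φ)
  nlinarith [sq_nonneg s]

/-- Points at a small distance have close angles. -/
lemma mul_abs_angle_sub_le {r s θ φ : ℝ} (hr : 0 ≤ r) (hs : 0 ≤ s) (h : |θ - φ| ≤ Real.pi) :
    s * |θ - φ| ≤ Real.pi * dist (polarPoint r θ) (polarPoint s φ) := by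
  have hpi := Real.pi_pos
  refine le_of_sq_le_sq ?_ (by positivity)
  rw [mul_pow, mul_pow, dist_polarPoint_sq, sq_abs]
  have hcos : Real.cos (θ - φ) = Real.cos |θ - φ| := (Real.cos_abs _).symm
  rw [hcos, ← sq_abs (θ - φ)]
  set d := |θ - φ| with hd
  have hd0 : 0 ≤ d := abs_nonneg _
  -- For an acute angle the distance is at least `s * sin d`, the distance to the line through the
  -- origin at angle `θ`, and Jordan's inequality bounds `sin d` below. For an obtuse angle the
  -- distance is at least `s`, and `d ≤ π`.
  rcases le_total d (Real.pi / 2) with hle | hle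
  · have h1 := Real.mul_le_sin hd0 hle
    have h2 : d ≤ Real.pi * Real.sin d := by
      have h3 : 2 * d ≤ Real.pi * Real.sin d := by
        calc 2 * d = Real.pi * (2 / Real.pi * d) := by field_simp
          _ ≤ _ := by gcongr
      linarith
    have h4 : d ^ 2 ≤ Real.pi ^ 2 * Real.sin d ^ 2 := by
      rw [← mul_pow]; gcongr
    calc s ^ 2 * d ^ 2 ≤ s ^ 2 * (Real.pi ^ 2 * Real.sin d ^ 2) := by gcongr
      _ = Real.pi ^ 2 * (s ^ 2 * Real.sin d ^ 2) := by ring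
      _ ≤ _ := by
        gcongr
        nlinarith [sq_nonneg (r - s * Real.cos d), Real.sin_sq_add_cos_sq d]
  · have h1 : Real.cos d ≤ 0 := Real.cos_nonpos_of_pi_div_two_le_of_le hle (by linarith)
    have h2 : s ^ 2 ≤ (r - s) ^ 2 + 2 * r * s * (1 - Real.cos d) := by
      nlinarith [mul_nonneg (mul_nonneg hr hs) (neg_nonneg.2 h1), sq_nonneg r]
    calc s ^ 2 * d ^ 2 ≤ s ^ 2 * Real.pi ^ 2 := by gcongr
      _ = Real.pi ^ 2 * s ^ 2 := by ring
      _ ≤ _ := by gcongr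

lemma polarPoint_add_int_mul (r φ : ℝ) (k : ℤ) :
    polarPoint r (φ + k * (2 * Real.pi)) = polarPoint r φ := by
  simp only [polarPoint, Real.cos_add_int_mul_two_pi, Real.sin_add_int_mul_two_pi]

/-- The free cut `c` allows the angle to be chosen within `π` of a prescribed one, or in the turn
just after a prescribed angle. -/
lemma exists_polarPoint_eq (x : EuclideanSpace ℝ (Fin 2)) (c : ℝ) :
    ∃ r θ : ℝ, 0 ≤ r ∧ c < θ ∧ θ ≤ c + 2 * Real.pi ∧ x = polarPoint r θ := by
  set z : ℂ := ⟨x 0, x 1⟩ with hz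
  have hmem := toIocMod_mem_Ioc Real.two_pi_pos c (Complex.arg z)
  refine ⟨‖z‖, toIocMod Real.two_pi_pos c (Complex.arg z), norm_nonneg _, hmem.1, hmem.2, ?_⟩
  have h : toIocMod Real.two_pi_pos c (Complex.arg z)
      = Complex.arg z + (-toIocDiv Real.two_pi_pos c (Complex.arg z) : ℤ) * (2 * Real.pi) := by
    rw [toIocMod]; push_cast; rw [zsmul_eq_mul]; ring
  rw [h, polarPoint_add_int_mul]
  ext i
  fin_cases i
  · simp [polarPoint, Complex.norm_mul_cos_arg, hz]
  · simp [polarPoint, Complex.norm_mul_sin_arg, hz]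

lemma eq_and_angle_eq_of_polarPoint_eq {r s θ φ : ℝ} (hr : 0 < r) (hs : 0 < s)
    (h : polarPoint r θ = polarPoint s φ) : r = s ∧ ∃ k : ℤ, θ = φ + k * (2 * Real.pi) := by
  have h1 : r = s := by
    have := congrArg norm h
    rwa [norm_polarPoint, norm_polarPoint, abs_of_pos hr, abs_of_pos hs] at this
  subst h1
  refine ⟨rfl, ?_⟩
  have h2 := dist_polarPoint_sq r r θ φ
  rw [h, dist_self] at h2
  have h3 : Real.cos (θ - φ) = 1 := by
    have : 2 * r * r * (1 - Real.cos (θ - φ)) = 0 := by linarith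
    have := (mul_eq_zero.1 this).resolve_left (by positivity)
    linarith
  obtain ⟨k, hk⟩ := (Real.cos_eq_one_iff _).1 h3
  exact ⟨k, by linarith⟩

/-! ### Area of radial strips -/

lemma volume_polarPoint_image (S : Set (ℝ × ℝ)) :
    volume ((fun p : ℝ × ℝ => polarPoint p.1 p.2) '' S) = volume (polarCoord.symm '' S) := by
  let e : EuclideanSpace ℝ (Fin 2) ≃ᵐ ℝ × ℝ :=
    (MeasurableEquiv.toLp 2 (Fin 2 → ℝ)).symm.trans MeasurableEquiv.finTwoArrow
  have he : MeasurePreserving e :=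
    (volume_preserving_finTwoArrow ℝ).comp
      (EuclideanSpace.volume_preserving_symm_measurableEquiv_toLp (Fin 2))
  have him : polarCoord.symm '' S
      = e.symm ⁻¹' ((fun p : ℝ × ℝ => polarPoint p.1 p.2) '' S) := by
    rw [← MeasurableEquiv.image_eq_preimage_symm, Set.image_image]
    rfl
  rw [him, he.symm.measure_preimage_equiv]

/-- The strip of polar coordinates around the graph `r = f φ`. -/
def polarStrip (f : ℝ → ℝ) (ε a b : ℝ) : Set (ℝ × ℝ) :=
  {p | p.2 ∈ Set.Icc a b ∧ |p.1 - f p.2| < ε}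

lemma measurableSet_polarStrip {f : ℝ → ℝ} (hf : Continuous f) (ε a b : ℝ) :
    MeasurableSet (polarStrip f ε a b) := by
  apply MeasurableSet.inter
  · exact measurable_snd measurableSet_Icc
  · have h : Continuous fun p : ℝ × ℝ => |p.1 - f p.2| := by fun_prop
    exact (isOpen_lt h continuous_const).measurableSet

lemma lintegral_polarStrip {f : ℝ → ℝ} (hf : Continuous f) (ε a b : ℝ) :
    ∫⁻ p in polarStrip f ε a b, ENNReal.ofReal |p.1|
      = ∫⁻ φ in Set.Icc a b, ∫⁻ r in Set.Ioo (f φ - ε) (f φ + ε), ENNReal.ofReal |r| := by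
  rw [← lintegral_indicator (measurableSet_polarStrip hf ε a b), Measure.volume_eq_prod,
    lintegral_prod_symm' _ ((by fun_prop : Measurable fun p : ℝ × ℝ => ENNReal.ofReal |p.1|).indicator
      (measurableSet_polarStrip hf ε a b)), ← lintegral_indicator measurableSet_Icc]
  congr 1 with φ
  by_cases hφ : φ ∈ Set.Icc a b
  · rw [Set.indicator_of_mem hφ, ← lintegral_indicator measurableSet_Ioo]
    congr 1 with r
    have : (r, φ) ∈ polarStrip f ε a b ↔ r ∈ Set.Ioo (f φ - ε) (f φ + ε) := by
      simp only [polarStrip, Set.mem_ofPred_eq, hφ, true_and, abs_lt, Set.mem_Ioo]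
      constructor <;> rintro ⟨h1, h2⟩ <;> constructor <;> linarith
    by_cases h : r ∈ Set.Ioo (f φ - ε) (f φ + ε)
    · rw [Set.indicator_of_mem h, Set.indicator_of_mem (this.2 h)]
    · rw [Set.indicator_of_notMem h, Set.indicator_of_notMem (fun h' => h (this.1 h'))]
  · rw [Set.indicator_of_notMem hφ]
    have : ∀ r, (r, φ) ∉ polarStrip f ε a b := fun r h => hφ h.1
    simp [this]

/-- The change of variables gives an upper bound without injectivity, so overlapping turns and
negative `r` do no harm. The Jacobian `|r|` is bounded by `f φ + ε`; the excess `2ε²` per unit angle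
disappears after rescaling. -/
lemma volume_image_polarStrip_le {f : ℝ → ℝ} (hf : Continuous f) {ε a b : ℝ} (hab : a ≤ b)
    (hε : 0 ≤ ε) (hf0 : ∀ φ ∈ Set.Icc a b, 0 ≤ f φ) :
    volume ((fun p : ℝ × ℝ => polarPoint p.1 p.2) '' polarStrip f ε a b)
      ≤ ENNReal.ofReal (∫ φ in a..b, 2 * ε * (f φ + ε)) := by
  rw [volume_polarPoint_image]
  refine (addHaar_image_le_lintegral_abs_det_fderiv volume (measurableSet_polarStrip hf ε a b)
    (fun p _ => (hasFDerivAt_polarCoord_symm p).hasFDerivWithinAt)).trans ?_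
  simp_rw [det_fderivPolarCoordSymm]
  rw [lintegral_polarStrip hf, intervalIntegral.integral_of_le hab, ← integral_Icc_eq_integral_Ioc,
    ofReal_integral_eq_lintegral_ofReal
      (Continuous.integrableOn_Icc (by fun_prop))
      ((ae_restrict_iff' measurableSet_Icc).2 (ae_of_all _ fun φ hφ => by
        have := hf0 φ hφ
        simp only [Pi.zero_apply]; positivity))]
  refine setLIntegral_mono (by fun_prop) fun φ hφ => ?_
  have h0 := hf0 φ hφ
  calc ∫⁻ r in Set.Ioo (f φ - ε) (f φ + ε), ENNReal.ofReal |r|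
      ≤ ∫⁻ r in Set.Ioo (f φ - ε) (f φ + ε), ENNReal.ofReal (f φ + ε) :=
        setLIntegral_mono (by fun_prop) fun r hr => ENNReal.ofReal_le_ofReal
          (abs_le.2 ⟨by linarith [hr.1], hr.2.le⟩)
    _ = ENNReal.ofReal (2 * ε * (f φ + ε)) := by
        rw [setLIntegral_const, Real.volume_Ioo, ← ENNReal.ofReal_mul (by linarith)]
        congr 1; ring

/-- Injectivity makes the change of variables exact, and the integral of `r` over an interval of
half-length `ε` centred at `f φ` is exactly `2ε f φ`. -/
lemma le_volume_image_polarStrip {f : ℝ → ℝ} (hf : Continuous f) {ε a b : ℝ} (hab : a ≤ b)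
    (hε : 0 ≤ ε) (hf0 : ∀ φ ∈ Set.Icc a b, ε ≤ f φ)
    (hinj : Set.InjOn (fun p : ℝ × ℝ => polarPoint p.1 p.2) (polarStrip f ε a b)) :
    ENNReal.ofReal (∫ φ in a..b, 2 * ε * f φ)
      ≤ volume ((fun p : ℝ × ℝ => polarPoint p.1 p.2) '' polarStrip f ε a b) := by
  have hinj' : Set.InjOn polarCoord.symm (polarStrip f ε a b) := by
    intro p hp q hq h
    have h' : (p.1 * Real.cos p.2, p.1 * Real.sin p.2)
      = (q.1 * Real.cos q.2, q.1 * Real.sin q.2) := h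
    refine hinj hp hq ?_
    obtain ⟨h1, h2⟩ := Prod.mk.inj h'
    simp only [polarPoint, h1, h2]
  rw [volume_polarPoint_image, ← lintegral_abs_det_fderiv_eq_addHaar_image volume
    (measurableSet_polarStrip hf ε a b)
    (fun p _ => (hasFDerivAt_polarCoord_symm p).hasFDerivWithinAt) hinj']
  simp_rw [det_fderivPolarCoordSymm]
  rw [lintegral_polarStrip hf, intervalIntegral.integral_of_le hab, ← integral_Icc_eq_integral_Ioc,
    ofReal_integral_eq_lintegral_ofReal
      (Continuous.integrableOn_Icc (by fun_prop))
      ((ae_restrict_iff' measurableSet_Icc).2 (ae_of_all _ fun φ hφ => by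
        have := hε.trans (hf0 φ hφ)
        simp only [Pi.zero_apply]; positivity))]
  refine setLIntegral_mono' measurableSet_Icc fun φ hφ => ?_
  have h0 := hf0 φ hφ
  have key : ∫ r in (f φ - ε)..(f φ + ε), r = 2 * ε * f φ := by
    rw [integral_id]; ring
  rw [← key, intervalIntegral.integral_of_le (by linarith), integral_Ioc_eq_integral_Ioo,
    ofReal_integral_eq_lintegral_ofReal
      ((Continuous.integrableOn_Icc (by fun_prop)).mono_set Set.Ioo_subset_Icc_self)
      ((ae_restrict_iff' measurableSet_Ioo).2 (ae_of_all _ fun r hr => by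
        simp only [Pi.zero_apply]; linarith [hr.1]))]
  exact setLIntegral_mono (by fun_prop) fun r hr => ENNReal.ofReal_le_ofReal (le_abs_self r)

/-! ### The outer arc -/

lemma volume_ball_plane {r : ℝ} (hr : 0 ≤ r) (x : EuclideanSpace ℝ (Fin 2)) :
    volume (Metric.ball x r) = ENNReal.ofReal (Real.pi * r ^ 2) := by
  rw [EuclideanSpace.volume_ball_fin_two, ← ENNReal.ofReal_pow hr, mul_comm Real.pi,
    ENNReal.ofReal_mul (by positivity)]

/-- The neighbourhoods of a rectifiable arc in the plane have area `O(ε)`. -/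
lemma exists_volume_thickening_arc_le {γ : ℝ → EuclideanSpace ℝ (Fin 2)} {L a b : ℝ} (hL : 0 ≤ L)
    (hab : a ≤ b)
    (hγ : ∀ s ∈ Set.Icc a b, ∀ t ∈ Set.Icc a b, dist (γ s) (γ t) ≤ L * |s - t|) :
    ∃ K : ℝ, 0 ≤ K ∧ ∀ ε : ℝ, 0 < ε → ε ≤ 1 →
      volume (Metric.thickening ε (γ '' Set.Icc a b)) ≤ ENNReal.ofReal (K * ε) := by
  set c := L * (b - a) + 1 with hc
  have hba : 0 ≤ b - a := by linarith
  have hc0 : 0 ≤ c := by positivity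
  refine ⟨3 * (Real.pi * c ^ 2), by positivity, fun ε hε hε1 => ?_⟩
  -- The centres are the images of `N + 1` equally spaced parameters with spacing at most `(b - a)
  -- ε`. Hence radius `c ε` suffices, and `(N + 1) ε ≤ 3`.
  set N := ⌈1 / ε⌉₊ with hN
  have hN1 : 1 / ε ≤ N := Nat.le_ceil _
  have hN2 : (N : ℝ) < 1 / ε + 1 := Nat.ceil_lt_add_one (by positivity)
  have hNpos : (0 : ℝ) < N := lt_of_lt_of_le (by positivity) hN1
  have hNε : 1 ≤ N * ε := by rwa [div_le_iff₀ hε] at hN1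
  have hsub : Metric.thickening ε (γ '' Set.Icc a b)
      ⊆ ⋃ i ∈ Finset.range (N + 1), Metric.ball (γ (a + (b - a) * i / N)) (c * ε) := by
    intro x hx
    obtain ⟨_, ⟨t, ht, rfl⟩, hxt⟩ := Metric.mem_thickening_iff.1 hx
    obtain ⟨i, hiN, hi0, hi1⟩ : ∃ i : ℕ, i ≤ N ∧ 0 ≤ t - (a + (b - a) * i / N) ∧
        t - (a + (b - a) * i / N) ≤ (b - a) * ε := by
      -- The case `a = b` is separate because the index is the floor of a quotient by `b - a`.
      rcases hba.eq_or_lt with h0 | h0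
      · refine ⟨0, Nat.zero_le _, ?_⟩
        simp only [← h0, zero_mul, zero_div, add_zero]
        constructor <;> linarith [ht.1, ht.2]
      · have hq0 : 0 ≤ (t - a) * N / (b - a) := by
          have := ht.1
          have : 0 ≤ t - a := by linarith
          positivity
        have hfl := Nat.floor_le hq0
        have hfl2 := Nat.lt_floor_add_one ((t - a) * N / (b - a))
        set i := ⌊(t - a) * N / (b - a)⌋₊
        refine ⟨i, ?_, ?_, ?_⟩
        · have : (i : ℝ) ≤ N := hfl.trans (by
            rw [div_le_iff₀ h0]; nlinarith [ht.2])
          exact_mod_cast this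
        · rw [le_div_iff₀ h0] at hfl
          have : (b - a) * i / N ≤ t - a := by rw [div_le_iff₀ hNpos]; linarith
          linarith
        · rw [div_lt_iff₀ h0] at hfl2
          have h3 : t - a ≤ (b - a) * i / N + (b - a) / N := by
            rw [← add_div, le_div_iff₀ hNpos]; nlinarith
          have h4 : (b - a) / N ≤ (b - a) * ε := by
            rw [div_le_iff₀ hNpos]; nlinarith
          linarith
    have hmem : a + (b - a) * i / N ∈ Set.Icc a b := by
      refine ⟨?_, by linarith [ht.2]⟩
      have : 0 ≤ (b - a) * i / N := by positivity
      linarith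
    refine Set.mem_biUnion (Finset.mem_coe.2 (Finset.mem_range.2 (Nat.lt_succ_of_le hiN))) ?_
    rw [Metric.mem_ball]
    calc dist x _ ≤ dist x (γ t) + dist (γ t) _ := dist_triangle _ _ _
      _ < ε + L * |t - (a + (b - a) * i / N)| := add_lt_add_of_lt_of_le hxt (hγ _ ht _ hmem)
      _ ≤ ε + L * ((b - a) * ε) := by rw [abs_of_nonneg hi0]; gcongr
      _ = c * ε := by rw [hc]; ring
  calc volume (Metric.thickening ε (γ '' Set.Icc a b))
      ≤ ∑ i ∈ Finset.range (N + 1), volume (Metric.ball (γ (a + (b - a) * i / N)) (c * ε)) :=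
        (measure_mono hsub).trans (measure_biUnion_finset_le _ _)
    _ = ENNReal.ofReal ((N + 1) * (Real.pi * (c * ε) ^ 2)) := by
        simp_rw [volume_ball_plane (mul_nonneg hc0 hε.le)]
        rw [Finset.sum_const, Finset.card_range, nsmul_eq_mul,
          ENNReal.ofReal_mul (p := (N : ℝ) + 1) (by positivity)]
        congr 1
        exact_mod_cast (ENNReal.ofReal_natCast (N + 1)).symm
    _ ≤ _ := by
        apply ENNReal.ofReal_le_ofReal
        have h1 : (N + 1) * ε ≤ 3 := by
          have : (N : ℝ) * ε < 1 + ε := by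
            calc (N : ℝ) * ε < (1 / ε + 1) * ε := by gcongr
              _ = 1 + ε := by field_simp
          nlinarith
        calc (N + 1) * (Real.pi * (c * ε) ^ 2)
            = ((N + 1) * ε) * (Real.pi * c ^ 2 * ε) := by ring
          _ ≤ 3 * (Real.pi * c ^ 2 * ε) := by gcongr
          _ = _ := by ring

lemma spiral_eq_image (f : ℝ → ℝ) (a : ℝ) :
    spiral f a = (fun φ => polarPoint (f φ) φ) '' Set.Ici a := by
  ext x
  constructor
  · rintro ⟨φ, h, rfl⟩
    exact ⟨φ, h, rfl⟩
  · rintro ⟨φ, h, rfl⟩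
    exact ⟨φ, h, rfl⟩

lemma spiral_subset_spiral (f : ℝ → ℝ) {a b : ℝ} (h : a ≤ b) : spiral f b ⊆ spiral f a := by
  rintro x ⟨φ, hφ, rfl⟩
  exact ⟨φ, h.trans hφ, rfl⟩

/-- The neighbourhoods of the outer part of a spiral have area `O(ε)`. -/
lemma exists_volume_thickening_spiral_le {f f' : ℝ → ℝ} {a b : ℝ} (hab : a ≤ b)
    (hf : ∀ φ, a ≤ φ → HasDerivWithinAt f (f' φ) (Set.Ici a) φ)
    (hf' : ContinuousOn f' (Set.Ici a)) :
    ∃ K : ℝ, 0 ≤ K ∧ ∀ ε : ℝ, 0 < ε → ε ≤ 1 →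
      volume (Metric.thickening ε (spiral f a))
        ≤ ENNReal.ofReal (K * ε) + volume (Metric.thickening ε (spiral f b)) := by
  obtain ⟨B, hB⟩ := isCompact_Icc.exists_bound_of_continuousOn
    (hf'.mono (Set.Icc_subset_Ici_self : Set.Icc a b ⊆ Set.Ici a))
  have hfc : ContinuousOn f (Set.Icc a b) := fun x hx =>
    (hf x hx.1).continuousWithinAt.mono Set.Icc_subset_Ici_self
  obtain ⟨D, hD⟩ := isCompact_Icc.exists_bound_of_continuousOn hfc
  have ha : a ∈ Set.Icc a b := Set.left_mem_Icc.2 hab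
  have hB0 : 0 ≤ B := (norm_nonneg _).trans (hB a ha)
  have hD0 : 0 ≤ D := (norm_nonneg _).trans (hD a ha)
  -- The Lipschitz constant is `B` for the radial move plus `D` for the angular move.
  obtain ⟨K, hK0, hK⟩ := exists_volume_thickening_arc_le
    (γ := fun φ => polarPoint (f φ) φ) (L := B + D) (by positivity) hab (by
      intro s hs t ht
      have h1 := (convex_Icc a b).norm_image_sub_le_of_norm_hasDerivWithin_le
        (fun x hx => (hf x hx.1).mono Set.Icc_subset_Ici_self) hB ht hs
      calc dist (polarPoint (f s) s) (polarPoint (f t) t)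
          ≤ dist (polarPoint (f s) s) (polarPoint (f t) s)
            + dist (polarPoint (f t) s) (polarPoint (f t) t) := dist_triangle _ _ _
        _ ≤ B * |s - t| + D * |s - t| := by
            refine add_le_add ?_ ?_
            · rw [dist_polarPoint_same_angle]
              exact h1
            · refine (dist_polarPoint_same_radius_le _ _ _).trans ?_
              gcongr
              exact hD t ht
        _ = _ := by ring)
  refine ⟨K, hK0, fun ε hε hε1 => ?_⟩
  have hunion : spiral f a = (fun φ => polarPoint (f φ) φ) '' Set.Icc a b ∪ spiral f b := by
    rw [spiral_eq_image, spiral_eq_image, ← Set.image_union, Set.Icc_union_Ici_eq_Ici hab]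
  rw [hunion, Metric.thickening_union]
  exact (measure_union_le _ _).trans (add_le_add (hK ε hε hε1) le_rfl)

/-! ### Neighbourhoods of a spiral against discs and strips -/

/-- A point `(r, θ)` within `ε` of the spiral point at angle `φ` has `|θ - φ|` controlled by the
distance, so `hlip` makes replacing `f φ` by `f θ` cost at most `δ ε`. If `θ` exceeds `b`,
monotonicity puts the point in the disc. The shift by `π` leaves room for `θ` below `φ`. -/
lemma thickening_spiral_subset {f : ℝ → ℝ} {δ ε a b : ℝ} (hδ : 0 ≤ δ)
    (hpos : ∀ φ, a - Real.pi ≤ φ → 0 ≤ f φ)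
    (hanti : AntitoneOn f (Set.Ici (a - Real.pi))) (hab : a - Real.pi ≤ b)
    (hlip : ∀ φ, a ≤ φ → ∀ θ, |θ - φ| ≤ Real.pi →
      Real.pi * |f θ - f φ| ≤ δ * (f φ * |θ - φ|)) :
    Metric.thickening ε (spiral f a) ⊆ Metric.ball 0 (f b + (1 + δ) * ε) ∪
      (fun p : ℝ × ℝ => polarPoint p.1 p.2) '' polarStrip f ((1 + δ) * ε) (a - Real.pi) b := by
  intro x hx
  obtain ⟨_, ⟨φ, hφ, rfl⟩, hxt⟩ := Metric.mem_thickening_iff.1 hx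
  change dist x (polarPoint (f φ) φ) < ε at hxt
  have hpi := Real.pi_pos
  obtain ⟨r, θ, hr, hθ1, hθ2, rfl⟩ := exists_polarPoint_eq x (φ - Real.pi)
  have hf0 : 0 ≤ f φ := hpos φ (by linarith)
  have hang : |θ - φ| ≤ Real.pi := abs_le.2 ⟨by linarith, by linarith⟩
  have h1 := abs_sub_le_dist_polarPoint hr hf0 θ φ
  have h2 := mul_abs_angle_sub_le hr hf0 hang
  have h3 : |f θ - f φ| ≤ δ * dist (polarPoint r θ) (polarPoint (f φ) φ) := by
    have := (hlip φ hφ θ hang).trans (mul_le_mul_of_nonneg_left h2 hδ)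
    rw [← mul_assoc, mul_comm δ, mul_assoc] at this
    exact le_of_mul_le_mul_left this hpi
  have h4 : |r - f θ| < (1 + δ) * ε := by
    calc |r - f θ| ≤ |r - f φ| + |f φ - f θ| := abs_sub_le _ _ _
      _ ≤ (1 + δ) * dist (polarPoint r θ) (polarPoint (f φ) φ) := by
        rw [abs_sub_comm (f φ)]; linarith
      _ < _ := by gcongr
  rcases le_total θ b with h | h
  · exact Or.inr ⟨(r, θ), ⟨⟨by linarith, h⟩, h4⟩, rfl⟩
  · left
    rw [Metric.mem_ball, dist_zero_right, norm_polarPoint, abs_of_nonneg hr]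
    have := hanti (Set.mem_Ici.2 hab) (Set.mem_Ici.2 (hab.trans h)) h
    linarith [(abs_lt.1 h4).2]

lemma volume_thickening_spiral_le {f : ℝ → ℝ} (hf : Continuous f) {δ ε a b : ℝ} (hδ : 0 ≤ δ)
    (hε : 0 ≤ ε) (hpos : ∀ φ, a - Real.pi ≤ φ → 0 ≤ f φ)
    (hanti : AntitoneOn f (Set.Ici (a - Real.pi))) (hab : a - Real.pi ≤ b)
    (hlip : ∀ φ, a ≤ φ → ∀ θ, |θ - φ| ≤ Real.pi →
      Real.pi * |f θ - f φ| ≤ δ * (f φ * |θ - φ|)) :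
    volume (Metric.thickening ε (spiral f a)) ≤
      ENNReal.ofReal (Real.pi * (f b + (1 + δ) * ε) ^ 2
        + ∫ φ in (a - Real.pi)..b, 2 * ((1 + δ) * ε) * (f φ + (1 + δ) * ε)) := by
  have hb := hpos b hab
  rw [ENNReal.ofReal_add (by positivity) (intervalIntegral.integral_nonneg hab fun φ hφ => by
    have := hpos φ hφ.1
    positivity)]
  refine (measure_mono (thickening_spiral_subset hδ hpos hanti hab hlip)).trans
    ((measure_union_le _ _).trans (add_le_add (volume_ball_plane (by positivity) _).le ?_))
  exact volume_image_polarStrip_le hf hab (by positivity) fun φ hφ => hpos φ hφ.1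

/-- Two representations of one point have equal radii and angles differing by full turns. If at
least one turn separates them, `hgap` and monotonicity put the two values of `f` at least `2ε`
apart, yet both lie strictly within `ε` of `r`. -/
lemma injOn_polarStrip {f : ℝ → ℝ} {ε a b : ℝ} (hpos : ∀ φ ∈ Set.Icc a b, ε ≤ f φ)
    (hanti : AntitoneOn f (Set.Ici a))
    (hgap : ∀ φ, a ≤ φ → φ + 2 * Real.pi ≤ b → 2 * ε ≤ f φ - f (φ + 2 * Real.pi)) :
    Set.InjOn (fun p : ℝ × ℝ => polarPoint p.1 p.2) (polarStrip f ε a b) := by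
  have hpi := Real.pi_pos
  have key : ∀ r θ φ : ℝ, (r, θ) ∈ polarStrip f ε a b → (r, φ) ∈ polarStrip f ε a b →
      ∀ k : ℤ, φ = θ + k * (2 * Real.pi) → k ≤ 0 := by
    intro r θ φ h1 h2 k hk
    by_contra! hk0
    have hk1 : (1 : ℝ) ≤ k := by exact_mod_cast hk0
    have h3 : θ + 2 * Real.pi ≤ φ := by rw [hk]; nlinarith
    have h4 : a ≤ θ := h1.1.1
    have h5 := hgap θ h4 (h3.trans h2.1.2)
    have h6 := hanti (Set.mem_Ici.2 (by linarith : a ≤ θ + 2 * Real.pi))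
      (Set.mem_Ici.2 h2.1.1) h3
    have h7 := (abs_lt.1 h1.2).1
    have h8 := (abs_lt.1 h2.2).2
    simp only at h7 h8
    linarith
  rintro ⟨r, θ⟩ hp ⟨s, φ⟩ hq h
  have hr : 0 < r := by
    have h1 := (abs_lt.1 hp.2).1
    have h2 := hpos θ hp.1
    simp only at h1
    linarith
  have hs : 0 < s := by
    have h1 := (abs_lt.1 hq.2).1
    have h2 := hpos φ hq.1
    simp only at h1
    linarith
  obtain ⟨rfl, k, hk⟩ := eq_and_angle_eq_of_polarPoint_eq hr hs h
  have h1 := key r φ θ hq hp k hk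
  have h2 := key r θ φ hp hq (-k) (by push_cast; linarith)
  have h3 : k = 0 := by omega
  have h4 : θ = φ := by simpa [h3] using hk
  rw [h4]

/-- On each ray the spiral radii descend to zero in steps shorter than `2ε`, starting above `r`. The
first one below `r + ε` is therefore also above `r - ε`. -/
lemma ball_subset_thickening_spiral {f : ℝ → ℝ} {ε a c : ℝ} (hε : 0 < ε) (hac : a ≤ c)
    (hanti : AntitoneOn f (Set.Ici a)) (hlim : Tendsto f atTop (𝓝 0))
    (hgap : ∀ φ, c < φ → f φ - f (φ + 2 * Real.pi) < 2 * ε) :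
    Metric.ball 0 (f (c + 2 * Real.pi)) ⊆ Metric.thickening ε (spiral f a) := by
  intro x hx
  have hpi := Real.pi_pos
  obtain ⟨r, θ, hr, hθ1, hθ2, rfl⟩ := exists_polarPoint_eq x c
  rw [Metric.mem_ball, dist_zero_right, norm_polarPoint, abs_of_nonneg hr] at hx
  have hfθ : r < f θ := hx.trans_le
    (hanti (Set.mem_Ici.2 (by linarith)) (Set.mem_Ici.2 (by linarith)) hθ2)
  suffices h : ∃ k : ℕ, |r - f (θ + k * (2 * Real.pi))| < ε by
    obtain ⟨k, hk⟩ := h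
    have hk0 : 0 ≤ k * (2 * Real.pi) := by positivity
    rw [Metric.mem_thickening_iff]
    refine ⟨polarPoint (f (θ + k * (2 * Real.pi))) (θ + k * (2 * Real.pi)),
      ⟨_, by linarith, rfl⟩, ?_⟩
    have h := polarPoint_add_int_mul (f (θ + k * (2 * Real.pi))) θ k
    rw [Int.cast_natCast] at h
    rwa [h, dist_polarPoint_same_angle]
  have hex : ∃ k : ℕ, f (θ + k * (2 * Real.pi)) < r + ε := by
    have ht : Tendsto (fun k : ℕ => θ + k * (2 * Real.pi)) atTop atTop :=
      tendsto_atTop_add_const_left _ _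
        (tendsto_natCast_atTop_atTop.atTop_mul_const (by positivity))
    exact ((hlim.comp ht).eventually (gt_mem_nhds (by linarith : (0 : ℝ) < r + ε))).exists
  classical
  refine ⟨Nat.find hex, ?_⟩
  have h1 := Nat.find_spec hex
  rcases hk : Nat.find hex with _ | k
  · rw [hk] at h1
    simp only [Nat.cast_zero, zero_mul, add_zero] at h1 ⊢
    exact abs_lt.2 ⟨by linarith, by linarith⟩
  · rw [hk] at h1
    have h2 := not_lt.1 (Nat.find_min hex (m := k) (by omega))
    have hk0 : 0 ≤ k * (2 * Real.pi) := by positivity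
    have h3 := hgap (θ + k * (2 * Real.pi)) (by linarith)
    have h4 : θ + k * (2 * Real.pi) + 2 * Real.pi = θ + (k + 1 : ℕ) * (2 * Real.pi) := by
      push_cast; ring
    rw [h4] at h3
    exact abs_lt.2 ⟨by linarith, by linarith⟩

/-- For `φ ≤ b ≤ c` the gap gives `f φ ≥ f (c + 2π) + 2ε`, so the strip misses the disc and the
areas add. Two thresholds are allowed because the gap need not be monotone in `φ`; the turns between
`b` and `c` are discarded. -/
lemma le_volume_thickening_spiral {f : ℝ → ℝ} (hf : Continuous f) {ε a b c : ℝ} (hε : 0 < ε)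
    (hab : a ≤ b) (hac : a ≤ c) (hpos : ∀ φ, a ≤ φ → 0 ≤ f φ)
    (hanti : AntitoneOn f (Set.Ici a)) (hlim : Tendsto f atTop (𝓝 0))
    (hgap : ∀ φ, a ≤ φ → φ ≤ b → 2 * ε ≤ f φ - f (φ + 2 * Real.pi))
    (hbc : b ≤ c)
    (hgap' : ∀ φ, c < φ → f φ - f (φ + 2 * Real.pi) < 2 * ε) :
    ENNReal.ofReal (Real.pi * f (c + 2 * Real.pi) ^ 2 + ∫ φ in a..b, 2 * ε * f φ)
      ≤ volume (Metric.thickening ε (spiral f a)) := by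
  have hpi := Real.pi_pos
  have hsep : ∀ φ ∈ Set.Icc a b, f (c + 2 * Real.pi) + 2 * ε ≤ f φ := by
    intro φ hφ
    have h1 := hgap φ hφ.1 hφ.2
    have h2 := hanti (Set.mem_Ici.2 (by linarith [hφ.1] : a ≤ φ + 2 * Real.pi))
      (Set.mem_Ici.2 (by linarith : a ≤ c + 2 * Real.pi)) (by linarith [hφ.2])
    linarith
  have hρ := hpos (c + 2 * Real.pi) (by linarith)
  have hfε : ∀ φ ∈ Set.Icc a b, ε ≤ f φ := fun φ hφ => by linarith [hsep φ hφ]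
  have hinj := injOn_polarStrip hfε hanti fun φ h1 h2 => hgap φ h1 (by linarith)
  rw [ENNReal.ofReal_add (by positivity) (intervalIntegral.integral_nonneg hab fun φ hφ => by
    have := hpos φ hφ.1
    positivity), ← volume_ball_plane hρ 0]
  refine (add_le_add le_rfl (le_volume_image_polarStrip hf hab hε.le hfε hinj)).trans ?_
  rw [← measure_union' _ measurableSet_ball]
  · refine measure_mono (Set.union_subset
      (ball_subset_thickening_spiral hε hac hanti hlim hgap') ?_)
    rintro _ ⟨⟨r, φ⟩, ⟨hφ, hr⟩, rfl⟩
    rw [Metric.mem_thickening_iff]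
    refine ⟨polarPoint (f φ) φ, ⟨φ, hφ.1, rfl⟩, ?_⟩
    rwa [dist_polarPoint_same_angle]
  · rw [Set.disjoint_right]
    rintro _ ⟨⟨r, φ⟩, ⟨hφ, hr⟩, rfl⟩ hball
    rw [Metric.mem_ball, dist_zero_right, norm_polarPoint] at hball
    have h1 := (abs_lt.1 hr).1
    have h2 := hsep φ hφ
    have h3 := le_abs_self r
    simp only at h1 h2 hball
    linarith

/-! ### Consequences of the power-law asymptotics -/

section Asymptotics

variable {α C φ₀ : ℝ} {f f' : ℝ → ℝ}

lemma eventually_le_and_le_of_tendsto_div {u v : ℝ → ℝ} (hv : ∀ᶠ x in atTop, 0 < v x)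
    (h : Tendsto (fun x => u x / v x) atTop (𝓝 1)) {δ : ℝ} (hδ : 0 < δ) :
    ∀ᶠ x in atTop, (1 - δ) * v x ≤ u x ∧ u x ≤ (1 + δ) * v x := by
  filter_upwards [hv, h.eventually (lt_mem_nhds (by linarith : 1 - δ < 1)),
    h.eventually (gt_mem_nhds (by linarith : 1 < 1 + δ))] with x h0 h1 h2
  exact ⟨((lt_div_iff₀ h0).1 h1).le, ((div_lt_iff₀ h0).1 h2).le⟩

lemma eventually_power_bounds (hC : 0 < C)
    (hf : Tendsto (fun φ : ℝ => f φ / (C * φ ^ (-α))) atTop (𝓝 1)) {δ : ℝ} (hδ : 0 < δ) :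
    ∃ a : ℝ, 0 < a ∧ ∀ φ, a ≤ φ →
      (1 - δ) * (C * φ ^ (-α)) ≤ f φ ∧ f φ ≤ (1 + δ) * (C * φ ^ (-α)) := by
  obtain ⟨a, ha⟩ := eventually_atTop.1 (eventually_le_and_le_of_tendsto_div
    ((eventually_gt_atTop 0).mono fun x hx => mul_pos hC (Real.rpow_pos_of_pos hx _)) hf hδ)
  exact ⟨max a 1, by positivity, fun φ hφ => ha φ ((le_max_left _ _).trans hφ)⟩

lemma eventually_neg_deriv_bounds (hα : 0 < α) (hC : 0 < C)
    (hf' : Tendsto (fun φ : ℝ => f' φ / (-α * C * φ ^ (-α - 1))) atTop (𝓝 1))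
    {δ : ℝ} (hδ : 0 < δ) :
    ∃ a : ℝ, 0 < a ∧ ∀ φ, a ≤ φ →
      (1 - δ) * (α * C * φ ^ (-α - 1)) ≤ -f' φ ∧ -f' φ ≤ (1 + δ) * (α * C * φ ^ (-α - 1)) := by
  have h : Tendsto (fun φ : ℝ => -f' φ / (α * C * φ ^ (-α - 1))) atTop (𝓝 1) := by
    refine hf'.congr fun φ => ?_
    rw [← neg_div_neg_eq]; congr 1; ring
  obtain ⟨a, ha⟩ := eventually_atTop.1 (eventually_le_and_le_of_tendsto_div
    ((eventually_gt_atTop 0).mono fun x hx =>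
      mul_pos (mul_pos hα hC) (Real.rpow_pos_of_pos hx _)) h hδ)
  exact ⟨max a 1, by positivity, fun φ hφ => ha φ ((le_max_left _ _).trans hφ)⟩

lemma tendsto_zero_of_power_asymp (hα : 0 < α) (hC : 0 < C)
    (hf : Tendsto (fun φ : ℝ => f φ / (C * φ ^ (-α))) atTop (𝓝 1)) :
    Tendsto f atTop (𝓝 0) := by
  have h1 : Tendsto (fun φ : ℝ => C * φ ^ (-α)) atTop (𝓝 0) := by
    simpa using (tendsto_rpow_neg_atTop hα).const_mul C
  have h2 := hf.mul h1
  rw [mul_zero] at h2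
  refine h2.congr' ?_
  filter_upwards [eventually_gt_atTop 0] with φ hφ
  have := Real.rpow_pos_of_pos hφ (-α)
  field_simp

/-- By the mean value theorem the gap is `2π` times `-f'` at an intermediate angle. The factor `2`
is kept in front for comparison with `2ε`. -/
lemma gap_bounds {δ a φ : ℝ} (hα : 0 < α) (hC : 0 < C) (hδ0 : 0 < δ) (hδ1 : δ < 1) (ha : 0 < a)
    (hder : ∀ φ, a ≤ φ → HasDerivAt f (f' φ) φ)
    (hb : ∀ φ, a ≤ φ → (1 - δ) * (α * C * φ ^ (-α - 1)) ≤ -f' φ ∧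
      -f' φ ≤ (1 + δ) * (α * C * φ ^ (-α - 1))) (hφ : a ≤ φ) :
    2 * ((1 - δ) * (Real.pi * α * C)) * (φ + 2 * Real.pi) ^ (-(1 + α)) ≤ f φ - f (φ + 2 * Real.pi) ∧
      f φ - f (φ + 2 * Real.pi) ≤ 2 * ((1 + δ) * (Real.pi * α * C)) * φ ^ (-(1 + α)) := by
  have hpi := Real.pi_pos
  obtain ⟨c, hc, hcs⟩ := exists_hasDerivAt_eq_slope f f'
    (by linarith : φ < φ + 2 * Real.pi)
    (fun x hx => (hder x (hφ.trans hx.1)).continuousAt.continuousWithinAt)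
    (fun x hx => hder x (hφ.trans hx.1.le))
  rw [add_sub_cancel_left, eq_div_iff (by positivity)] at hcs
  have hφ0 : 0 < φ := ha.trans_le hφ
  have hc0 : 0 < c := hφ0.trans hc.1
  obtain ⟨h1, h2⟩ := hb c (hφ.trans hc.1.le)
  have hexp : -(1 + α) = -α - 1 := by ring
  rw [hexp]
  have h3 : (φ + 2 * Real.pi) ^ (-α - 1) ≤ c ^ (-α - 1) :=
    Real.rpow_le_rpow_of_nonpos hc0 hc.2.le (by linarith)
  have h4 : c ^ (-α - 1) ≤ φ ^ (-α - 1) :=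
    Real.rpow_le_rpow_of_nonpos hφ0 hc.1.le (by linarith)
  have h5 : 0 < 1 - δ := by linarith
  constructor
  · calc _ ≤ 2 * ((1 - δ) * (Real.pi * α * C)) * c ^ (-α - 1) := by gcongr
      _ = 2 * Real.pi * ((1 - δ) * (α * C * c ^ (-α - 1))) := by ring
      _ ≤ 2 * Real.pi * -f' c := by gcongr
      _ = _ := by linarith
  · calc _ = 2 * Real.pi * -f' c := by linarith
      _ ≤ 2 * Real.pi * ((1 + δ) * (α * C * c ^ (-α - 1))) := by gcongr
      _ = 2 * ((1 + δ) * (Real.pi * α * C)) * c ^ (-α - 1) := by ring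
      _ ≤ _ := by gcongr

lemma antitoneOn_of_neg_deriv_bound {a : ℝ}
    (hder : ∀ φ, a ≤ φ → HasDerivAt f (f' φ) φ) (hb : ∀ φ, a ≤ φ → 0 ≤ -f' φ) :
    AntitoneOn f (Set.Ici a) := by
  refine antitoneOn_of_hasDerivWithinAt_nonpos (f' := f') (convex_Ici a)
    (fun x hx => (hder x hx).continuousAt.continuousWithinAt)
    (fun x hx => (hder x (interior_subset hx)).hasDerivWithinAt)
    (fun x hx => by linarith [hb x (interior_subset hx)])

/-- The ratio `|f'| / f` is `O(1 / φ)`, uniformly over a half-turn on either side, hence eventually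
below `δ / π`. -/
lemma exists_angular_lipschitz (hα : 0 < α) (hC : 0 < C)
    (hder : ∀ φ, φ₀ < φ → HasDerivAt f (f' φ) φ)
    (hf : Tendsto (fun φ : ℝ => f φ / (C * φ ^ (-α))) atTop (𝓝 1))
    (hf' : Tendsto (fun φ : ℝ => f' φ / (-α * C * φ ^ (-α - 1))) atTop (𝓝 1))
    {δ : ℝ} (hδ : 0 < δ) :
    ∃ a : ℝ, ∀ φ, a ≤ φ → ∀ θ, |θ - φ| ≤ Real.pi →
      Real.pi * |f θ - f φ| ≤ δ * (f φ * |θ - φ|) := by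
  have hpi := Real.pi_pos
  obtain ⟨a₁, ha₁, hb₁⟩ := eventually_power_bounds hC hf (δ := 1 / 2) (by norm_num)
  obtain ⟨a₂, ha₂, hb₂⟩ := eventually_neg_deriv_bounds hα hC hf' (δ := 1 / 2) (by norm_num)
  -- Since `φ ≥ 2π`, angles within `π` of `φ` are at least `φ / 2`, which costs this factor. The
  -- last threshold below makes `(3/2) α C k φ ^ (-α - 1)` at most `(δ / π) (1/2) C φ ^ (-α)`.
  set k : ℝ := (2 : ℝ) ^ (α + 1) with hk
  have hk0 : 0 < k := by positivity
  refine ⟨max (max a₁ (a₂ + Real.pi)) (max (φ₀ + Real.pi + 1)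
    (max (2 * Real.pi) (3 * Real.pi * α * k / δ))), fun φ hφ θ hθ => ?_⟩
  simp only [max_le_iff] at hφ
  obtain ⟨⟨h1, h2⟩, h3, h4, h5⟩ := hφ
  have hφ0 : 0 < φ := by linarith
  have hbound : ∀ t ∈ Set.Icc (φ - Real.pi) (φ + Real.pi), ‖f' t‖ ≤ δ / Real.pi * f φ := by
    intro t ht
    have ht0 : φ / 2 ≤ t := by linarith [ht.1]
    obtain ⟨h6, h7⟩ := hb₂ t (by linarith [ht.1])
    have h8 : 0 < t ^ (-α - 1) := Real.rpow_pos_of_pos (by linarith) _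
    have h9 : 0 ≤ -f' t := le_trans (by positivity) h6
    have h10 : t ^ (-α - 1) ≤ (φ / 2) ^ (-α - 1) :=
      Real.rpow_le_rpow_of_nonpos (by positivity) ht0 (by linarith)
    have h11 : (φ / 2) ^ (-α - 1) = k * (φ ^ (-α) * φ⁻¹) := by
      rw [Real.div_rpow hφ0.le (by norm_num), Real.rpow_sub_one hφ0.ne', hk,
        show (-α - 1 : ℝ) = -(α + 1) by ring, Real.rpow_neg (by norm_num : (0 : ℝ) ≤ 2)]
      field_simp
    rw [Real.norm_eq_abs, ← abs_neg, abs_of_nonneg h9]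
    have h12 : 0 < φ ^ (-α) := Real.rpow_pos_of_pos hφ0 _
    have h13 : 3 * Real.pi * α * k ≤ φ * δ := (div_le_iff₀ hδ).1 h5
    calc -f' t ≤ (1 + 1 / 2) * (α * C * (k * (φ ^ (-α) * φ⁻¹))) := by
          rw [← h11]; exact h7.trans (by gcongr)
      _ = (3 * Real.pi * α * k) * (C * φ ^ (-α) / (2 * Real.pi * φ)) := by field_simp; ring
      _ ≤ (φ * δ) * (C * φ ^ (-α) / (2 * Real.pi * φ)) := by gcongr
      _ = δ / Real.pi * ((1 - 1 / 2) * (C * φ ^ (-α))) := by field_simp; ring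
      _ ≤ _ := by
        have := (hb₁ φ h1).1
        gcongr
  have h := (convex_Icc (φ - Real.pi) (φ + Real.pi)).norm_image_sub_le_of_norm_hasDerivWithin_le
    (fun x hx => (hder x (by linarith [hx.1])).hasDerivWithinAt) hbound
    (x := φ) (y := θ) ⟨by linarith, by linarith⟩
    ⟨by linarith [(abs_le.1 hθ).1], by linarith [(abs_le.1 hθ).2]⟩
  rw [Real.norm_eq_abs, Real.norm_eq_abs] at h
  calc Real.pi * |f θ - f φ| ≤ Real.pi * (δ / Real.pi * f φ * |θ - φ|) := by gcongr
    _ = _ := by field_simp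

/-! ### Rescaled two-sided area bounds -/

/-- The Minkowski content of the spirals with `f φ ∼ C φ ^ (-α)`. -/
noncomputable def spiralContent (α C : ℝ) : ℝ :=
  Real.pi * (C * ((Real.pi * α * C) ^ (1 / (1 + α))) ^ (-α)) ^ 2
    + 2 * (C * ((Real.pi * α * C) ^ (1 / (1 + α))) ^ (1 - α) / (1 - α))

lemma spiralContent_pos (hα₀ : 0 < α) (hα₁ : α < 1) (hC : 0 < C) : 0 < spiralContent α C := by
  have := Real.pi_pos
  have : 0 < 1 - α := by linarith
  unfold spiralContent
  positivity

lemma integral_rpow_neg {a b : ℝ} (hα₁ : α < 1) :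
    ∫ φ in a..b, φ ^ (-α) = (b ^ (1 - α) - a ^ (1 - α)) / (1 - α) := by
  rw [integral_rpow (Or.inl (by linarith)), show -α + 1 = 1 - α by ring]

lemma intervalIntegrable_rpow_neg {a b : ℝ} (hα₁ : α < 1) :
    IntervalIntegrable (fun φ : ℝ => φ ^ (-α)) volume a b :=
  intervalIntegral.intervalIntegrable_rpow' (by linarith)

/-- The covering by disc and strip is valid for any cut angle `A X`, so `A` stays free here. The `K`
term is the outer arc and `2 * A * X⁻¹` comes from the quadratic part of the strip area; both vanish
in the limit. -/
lemma eventually_volume_le (hα₀ : 0 < α) (hα₁ : α < 1) (hC : 0 < C) (hf : Continuous f)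
    (hder : ∀ φ, φ₀ ≤ φ → HasDerivWithinAt f (f' φ) (Set.Ici φ₀) φ)
    (hf'c : ContinuousOn f' (Set.Ici φ₀))
    (hfa : Tendsto (fun φ : ℝ => f φ / (C * φ ^ (-α))) atTop (𝓝 1))
    (hf'a : Tendsto (fun φ : ℝ => f' φ / (-α * C * φ ^ (-α - 1))) atTop (𝓝 1))
    {A : ℝ} (hA : 0 < A) {δ : ℝ} (hδ0 : 0 < δ) (hδ1 : δ < 1) :
    ∃ K : ℝ, ∀ᶠ X : ℝ in atTop,
      volume (Metric.thickening (X ^ (-(1 + α))) (spiral f φ₀)) * ENNReal.ofReal (X ^ (2 * α))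
        ≤ ENNReal.ofReal (K * X ^ (-(1 - α)) +
          (1 + δ) ^ 2 * (Real.pi * (C * A ^ (-α) + X⁻¹) ^ 2
            + 2 * (C * A ^ (1 - α) / (1 - α)) + 2 * A * X⁻¹)) := by
  have hpi := Real.pi_pos
  have hder' : ∀ φ, φ₀ < φ → HasDerivAt f (f' φ) φ := fun φ hφ =>
    (hder φ hφ.le).hasDerivAt (Ici_mem_nhds hφ)
  obtain ⟨a₁, ha₁, hb₁⟩ := eventually_power_bounds hC hfa hδ0
  obtain ⟨a₂, ha₂, hb₂⟩ := eventually_neg_deriv_bounds hα₀ hC hf'a hδ0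
  obtain ⟨a₃, hb₃⟩ := exists_angular_lipschitz hα₀ hC hder' hfa hf'a hδ0
  obtain ⟨a, h1, h2, h3, h4⟩ : ∃ a, a₁ ≤ a - Real.pi ∧ a₂ ≤ a - Real.pi ∧ a₃ ≤ a ∧
      φ₀ + 1 ≤ a - Real.pi :=
    ⟨max (max a₁ a₂) (max a₃ (φ₀ + 1)) + Real.pi, by simp, by simp,
      (by simp : a₃ ≤ max (max a₁ a₂) (max a₃ (φ₀ + 1))).trans (by linarith), by simp⟩
  obtain ⟨K, hK0, hK⟩ := exists_volume_thickening_spiral_le (by linarith : φ₀ ≤ a) hder hf'c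
  refine ⟨K, ?_⟩
  have ha0 : 0 < a - Real.pi := ha₁.trans_le h1
  have h1δ : 0 < 1 - δ := by linarith
  have h1α : 0 < 1 - α := by linarith
  have hpos : ∀ φ, a - Real.pi ≤ φ → 0 ≤ f φ := fun φ hφ => by
    have hφ0 : 0 < φ := ha0.trans_le hφ
    exact le_trans (by positivity) (hb₁ φ (h1.trans hφ)).1
  have hanti : AntitoneOn f (Set.Ici (a - Real.pi)) :=
    antitoneOn_of_neg_deriv_bound (fun φ hφ => hder' φ (by linarith)) fun φ hφ => by
      have hφ0 : 0 < φ := ha0.trans_le hφ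
      exact le_trans (by positivity) (hb₂ φ (h2.trans hφ)).1
  filter_upwards [eventually_ge_atTop 1, eventually_ge_atTop ((a - Real.pi) / A)] with X hX1 hXa
  have hX0 : 0 < X := by linarith
  rw [div_le_iff₀ hA, mul_comm] at hXa
  set ε := X ^ (-(1 + α)) with hε
  have hε0 : 0 < ε := Real.rpow_pos_of_pos hX0 _
  have hε1 : ε ≤ 1 := Real.rpow_le_one_of_one_le_of_nonpos hX1 (by linarith)
  have hv := (hK ε hε0 hε1).trans (add_le_add le_rfl
    (volume_thickening_spiral_le hf hδ0.le hε0.le hpos hanti hXa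
      (fun φ hφ => hb₃ φ (h3.trans hφ))))
  have hfb := hpos _ hXa
  rw [← ENNReal.ofReal_add (by positivity) (add_nonneg (by positivity)
    (intervalIntegral.integral_nonneg hXa fun φ hφ => by
      have := hpos φ hφ.1
      positivity))] at hv
  have hint : ∫ φ in (a - Real.pi)..(A * X), 2 * ((1 + δ) * ε) * (f φ + (1 + δ) * ε)
      ≤ (1 + δ) ^ 2 * (2 * ε * (C * (A * X) ^ (1 - α) / (1 - α) + ε * (A * X))) := by
    calc _ ≤ ∫ φ in (a - Real.pi)..(A * X),
          (1 + δ) ^ 2 * (2 * ε) * (C * φ ^ (-α) + ε) := by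
          refine intervalIntegral.integral_mono_on hXa
            (Continuous.intervalIntegrable (by fun_prop) _ _)
            ((((intervalIntegrable_rpow_neg hα₁).const_mul C).add
              intervalIntegrable_const).const_mul _) fun φ hφ => ?_
          have h5 := (hb₁ φ (h1.trans hφ.1)).2
          calc 2 * ((1 + δ) * ε) * (f φ + (1 + δ) * ε)
              ≤ 2 * ((1 + δ) * ε) * ((1 + δ) * (C * φ ^ (-α)) + (1 + δ) * ε) := by gcongr
            _ = _ := by ring
      _ = (1 + δ) ^ 2 * (2 * ε) * (C * (((A * X) ^ (1 - α) - (a - Real.pi) ^ (1 - α)) / (1 - α))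
            + (A * X - (a - Real.pi)) * ε) := by
          rw [intervalIntegral.integral_const_mul, intervalIntegral.integral_add
            ((intervalIntegrable_rpow_neg hα₁).const_mul C) intervalIntegrable_const,
            intervalIntegral.integral_const_mul, integral_rpow_neg hα₁,
            intervalIntegral.integral_const, smul_eq_mul]
      _ ≤ (1 + δ) ^ 2 * (2 * ε) * (C * ((A * X) ^ (1 - α) / (1 - α)) + (A * X) * ε) := by
          have h6 : 0 ≤ (a - Real.pi) ^ (1 - α) := by positivity
          gcongr
          · linarith
          · linarith
      _ = _ := by ring
  have hball : f (A * X) + (1 + δ) * ε ≤ (1 + δ) * (C * (A * X) ^ (-α) + ε) := by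
    linarith [(hb₁ _ (h1.trans hXa)).2]
  have hX2 : 0 < X ^ (2 * α) := Real.rpow_pos_of_pos hX0 _
  refine (mul_le_mul_left hv _).trans ?_
  rw [← ENNReal.ofReal_mul (add_nonneg (by positivity) (add_nonneg (by positivity)
    (intervalIntegral.integral_nonneg hXa fun φ hφ => by
      have := hpos φ hφ.1
      positivity)))]
  refine ENNReal.ofReal_le_ofReal ?_
  have e1 : ε * X ^ (2 * α) = X ^ (-(1 - α)) := by
    rw [hε, ← Real.rpow_add hX0]; congr 1; ring
  have e2 : X ^ (2 * α) = X ^ α * X ^ α := by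
    rw [← Real.rpow_add hX0]; congr 1; ring
  have e3 : (A * X) ^ (-α) * X ^ α = A ^ (-α) := by
    rw [Real.mul_rpow hA.le hX0.le, mul_assoc, ← Real.rpow_add hX0, neg_add_cancel,
      Real.rpow_zero, mul_one]
  have e4 : ε * X ^ α = X⁻¹ := by
    rw [hε, ← Real.rpow_add hX0, ← Real.rpow_neg_one]; congr 1; ring
  have e5 : X ^ (-(1 - α)) * (A * X) ^ (1 - α) = A ^ (1 - α) := by
    rw [Real.mul_rpow hA.le hX0.le, mul_left_comm, ← Real.rpow_add hX0, neg_add_cancel,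
      Real.rpow_zero, mul_one]
  have e6 : X⁻¹ * X = 1 := inv_mul_cancel₀ hX0.ne'
  calc _ ≤ (K * ε + (Real.pi * ((1 + δ) * (C * (A * X) ^ (-α) + ε)) ^ 2
        + (1 + δ) ^ 2 * (2 * ε * (C * (A * X) ^ (1 - α) / (1 - α) + ε * (A * X)))))
        * X ^ (2 * α) := by gcongr
    _ = K * (ε * X ^ (2 * α)) + (1 + δ) ^ 2 * (Real.pi *
          (C * ((A * X) ^ (-α) * X ^ α) + ε * X ^ α) ^ 2
        + 2 * (C * ((ε * X ^ (2 * α)) * (A * X) ^ (1 - α)) / (1 - α))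
        + 2 * A * ((ε * X ^ α) * ((ε * X ^ α) * X))) := by
        rw [e2]; ring
    _ = _ := by rw [e1, e3, e4, e5, e6, mul_one]

/-- `A` and `B` solve the equation "gap equals `2ε`" for the lower and upper bounds on the gap, so
turns are separated before about `A X` and merged after `B X`. -/
lemma eventually_le_volume (hα₀ : 0 < α) (hα₁ : α < 1) (hC : 0 < C) (hf : Continuous f)
    (hder : ∀ φ, φ₀ ≤ φ → HasDerivWithinAt f (f' φ) (Set.Ici φ₀) φ)
    (hfa : Tendsto (fun φ : ℝ => f φ / (C * φ ^ (-α))) atTop (𝓝 1))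
    (hf'a : Tendsto (fun φ : ℝ => f' φ / (-α * C * φ ^ (-α - 1))) atTop (𝓝 1))
    {δ : ℝ} (hδ0 : 0 < δ) (hδ1 : δ < 1) {A B : ℝ} (hA : 0 < A) (hB : 0 < B)
    (hA' : A ^ (1 + α) = (1 - δ) * (Real.pi * α * C))
    (hB' : B ^ (1 + α) = (1 + δ) * (Real.pi * α * C)) :
    ∃ a : ℝ, ∀ᶠ X : ℝ in atTop,
      ENNReal.ofReal (Real.pi * ((1 - δ) * (C * (B + 2 * Real.pi * X⁻¹) ^ (-α))) ^ 2
          + 2 * ((1 - δ) * (C * ((A - 2 * Real.pi * X⁻¹) ^ (1 - α)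
            - a ^ (1 - α) * X ^ (-(1 - α))) / (1 - α))))
      ≤ volume (Metric.thickening (X ^ (-(1 + α))) (spiral f φ₀))
          * ENNReal.ofReal (X ^ (2 * α)) := by
  have hpi := Real.pi_pos
  have hder' : ∀ φ, φ₀ < φ → HasDerivAt f (f' φ) φ := fun φ hφ =>
    (hder φ hφ.le).hasDerivAt (Ici_mem_nhds hφ)
  obtain ⟨a₁, ha₁, hb₁⟩ := eventually_power_bounds hC hfa hδ0
  obtain ⟨a₂, ha₂, hb₂⟩ := eventually_neg_deriv_bounds hα₀ hC hf'a hδ0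
  obtain ⟨a, h1, h2, h3⟩ : ∃ a, a₁ ≤ a ∧ a₂ ≤ a ∧ φ₀ + 1 ≤ a :=
    ⟨max (max a₁ a₂) (φ₀ + 1), by simp, by simp, by simp⟩
  refine ⟨a, ?_⟩
  have ha0 : 0 < a := ha₁.trans_le h1
  have h1δ : 0 < 1 - δ := by linarith
  have h1α : 0 < 1 - α := by linarith
  have hpos : ∀ φ, a ≤ φ → 0 ≤ f φ := fun φ hφ => by
    have hφ0 : 0 < φ := ha0.trans_le hφ
    exact le_trans (by positivity) (hb₁ φ (h1.trans hφ)).1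
  have hanti : AntitoneOn f (Set.Ici a) :=
    antitoneOn_of_neg_deriv_bound (fun φ hφ => hder' φ (by linarith)) fun φ hφ => by
      have hφ0 : 0 < φ := ha0.trans_le hφ
      exact le_trans (by positivity) (hb₂ φ (h2.trans hφ)).1
  have hgap := fun φ (hφ : a ≤ φ) => gap_bounds hα₀ hC hδ0 hδ1 ha0
    (fun φ hφ => hder' φ (by linarith)) (fun φ hφ => hb₂ φ (h2.trans hφ)) hφ
  have hAB : A ≤ B := by
    refine le_of_not_gt fun h => ?_
    have h4 := Real.rpow_lt_rpow hB.le h (by linarith : 0 < 1 + α)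
    rw [hA', hB'] at h4
    have : 0 < Real.pi * α * C := by positivity
    nlinarith
  filter_upwards [eventually_ge_atTop 1, eventually_ge_atTop ((a + 2 * Real.pi) / A)]
    with X hX1 hXa
  have hX0 : 0 < X := by linarith
  rw [div_le_iff₀ hA, mul_comm] at hXa
  set ε := X ^ (-(1 + α)) with hε
  have hε0 : 0 < ε := Real.rpow_pos_of_pos hX0 _
  have hABX : A * X ≤ B * X := by gcongr
  have hscale : ∀ D : ℝ, 0 < D → D ^ (1 + α) * (D * X) ^ (-(1 + α)) = ε := fun D hD => by
    rw [Real.mul_rpow hD.le hX0.le, ← mul_assoc, ← Real.rpow_add hD, add_neg_cancel,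
      Real.rpow_zero, one_mul]
  -- The lower gap bound at `φ` is evaluated at `φ + 2π`, so separation is only known up to `A * X -
  -- 2π`.
  have hv : _ ≤ volume (Metric.thickening ε (spiral f φ₀)) :=
    (le_volume_thickening_spiral hf hε0 (b := A * X - 2 * Real.pi) (c := B * X)
      (by linarith) (by linarith) hpos hanti (tendsto_zero_of_power_asymp hα₀ hC hfa)
      (fun φ hφ hφb => by
        refine le_trans ?_ (hgap φ hφ).1
        rw [← hscale A hA, hA', mul_assoc 2]
        gcongr 2 * (_ * ?_)
        exact Real.rpow_le_rpow_of_nonpos (by linarith) (by linarith) (by linarith))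
      (by linarith)
      (fun φ hφ => by
        have hBX : 0 < B * X := by positivity
        refine (hgap φ (by linarith)).2.trans_lt ?_
        rw [← hscale B hB, hB', mul_assoc 2]
        gcongr 2 * (_ * ?_)
        exact Real.rpow_lt_rpow_of_neg hBX hφ (by linarith))).trans
    (measure_mono (Metric.thickening_subset_of_subset _ (spiral_subset_spiral f (by linarith))))
  refine le_trans ?_ (mul_le_mul_left hv _)
  have hab : a ≤ A * X - 2 * Real.pi := by linarith
  rw [← ENNReal.ofReal_mul (add_nonneg (by positivity)
    (intervalIntegral.integral_nonneg hab fun φ hφ => by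
      have := hpos φ hφ.1
      positivity))]
  refine ENNReal.ofReal_le_ofReal ?_
  have hint : (1 - δ) * (2 * ε) * (C * (((A * X - 2 * Real.pi) ^ (1 - α) - a ^ (1 - α)) / (1 - α)))
      ≤ ∫ φ in a..(A * X - 2 * Real.pi), 2 * ε * f φ := by
    calc _ = ∫ φ in a..(A * X - 2 * Real.pi), (1 - δ) * (2 * ε) * (C * φ ^ (-α)) := by
          rw [intervalIntegral.integral_const_mul, intervalIntegral.integral_const_mul,
            integral_rpow_neg hα₁]
      _ ≤ _ := by
          refine intervalIntegral.integral_mono_on hab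
            (((intervalIntegrable_rpow_neg hα₁).const_mul C).const_mul _)
            (Continuous.intervalIntegrable (by fun_prop) _ _) fun φ hφ => ?_
          have h5 := (hb₁ φ (h1.trans hφ.1)).1
          calc (1 - δ) * (2 * ε) * (C * φ ^ (-α))
              = 2 * ε * ((1 - δ) * (C * φ ^ (-α))) := by ring
            _ ≤ _ := by gcongr
  have hball := (hb₁ (B * X + 2 * Real.pi) (by linarith)).1
  have hX2 : 0 < X ^ (2 * α) := Real.rpow_pos_of_pos hX0 _
  have e1 : ε * X ^ (2 * α) = X ^ (-(1 - α)) := by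
    rw [hε, ← Real.rpow_add hX0]; congr 1; ring
  have e2 : X ^ (2 * α) = X ^ α * X ^ α := by
    rw [← Real.rpow_add hX0]; congr 1; ring
  have e3 : (B * X + 2 * Real.pi) ^ (-α) * X ^ α = (B + 2 * Real.pi * X⁻¹) ^ (-α) := by
    rw [show B * X + 2 * Real.pi = (B + 2 * Real.pi * X⁻¹) * X by field_simp,
      Real.mul_rpow (by positivity) hX0.le, mul_assoc, ← Real.rpow_add hX0, neg_add_cancel,
      Real.rpow_zero, mul_one]
  have e5 : X ^ (-(1 - α)) * (A * X - 2 * Real.pi) ^ (1 - α)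
      = (A - 2 * Real.pi * X⁻¹) ^ (1 - α) := by
    have h6 : A * X - 2 * Real.pi = (A - 2 * Real.pi * X⁻¹) * X := by field_simp
    have h7 : 0 ≤ A - 2 * Real.pi * X⁻¹ := by
      refine nonneg_of_mul_nonneg_left ?_ hX0
      rw [← h6]; linarith
    rw [h6, Real.mul_rpow h7 hX0.le, mul_left_comm, ← Real.rpow_add hX0, neg_add_cancel,
      Real.rpow_zero, mul_one]
  have hbase : 0 < B * X + 2 * Real.pi := by positivity
  calc _ = (Real.pi * ((1 - δ) * (C * (B * X + 2 * Real.pi) ^ (-α))) ^ 2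
        + (1 - δ) * (2 * ε) *
          (C * (((A * X - 2 * Real.pi) ^ (1 - α) - a ^ (1 - α)) / (1 - α)))) * X ^ (2 * α) := by
        rw [← e3, ← e5, ← e1, e2]; ring
    _ ≤ _ := by gcongr

end Asymptotics

/-! ### The limit of the rescaled area -/

lemma tendsto_inv_rpow_mul_volume {α C φ₀ : ℝ} {f f' : ℝ → ℝ}
    (hα₀ : 0 < α) (hα₁ : α < 1) (hC : 0 < C) (hf : Continuous f)
    (hder : ∀ φ, φ₀ ≤ φ → HasDerivWithinAt f (f' φ) (Set.Ici φ₀) φ)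
    (hf'c : ContinuousOn f' (Set.Ici φ₀))
    (hfa : Tendsto (fun φ : ℝ => f φ / (C * φ ^ (-α))) atTop (𝓝 1))
    (hf'a : Tendsto (fun φ : ℝ => f' φ / (-α * C * φ ^ (-α - 1))) atTop (𝓝 1)) :
    Tendsto (fun X : ℝ => volume (Metric.thickening (X ^ (-(1 + α))) (spiral f φ₀))
      * ENNReal.ofReal (X ^ (2 * α))) atTop (𝓝 (ENNReal.ofReal (spiralContent α C))) := by
  have hpi := Real.pi_pos
  have h1α : 0 < 1 - α := by linarith
  have hinv : Tendsto (fun X : ℝ => X⁻¹) atTop (𝓝 0) := tendsto_inv_atTop_zero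
  have hpow : Tendsto (fun X : ℝ => X ^ (-(1 - α))) atTop (𝓝 0) := tendsto_rpow_neg_atTop h1α
  set Q : ℝ := Real.pi * α * C with hQ
  have hQ0 : 0 < Q := by positivity
  have hδmem : Set.Ioo (0 : ℝ) 1 ∈ 𝓝[>] (0 : ℝ) := Ioo_mem_nhdsGT one_pos
  -- For each `u` on either side of the limit, `δ` is fixed first so that the bound as `X → ∞` is
  -- still beyond `u`; then `X` is taken large.
  refine tendsto_order.2 ⟨fun u hu => ?_, fun u hu => ?_⟩
  · have hlim : Tendsto (fun δ : ℝ => ENNReal.ofReal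
        (Real.pi * ((1 - δ) * (C * (((1 + δ) * Q) ^ (1 / (1 + α))) ^ (-α))) ^ 2
          + 2 * ((1 - δ) * (C * (((1 - δ) * Q) ^ (1 / (1 + α))) ^ (1 - α) / (1 - α)))))
        (𝓝[>] 0) (𝓝 (ENNReal.ofReal (spiralContent α C))) := by
      refine ENNReal.tendsto_ofReal (Tendsto.mono_left ?_ nhdsWithin_le_nhds)
      have c1 : ContinuousAt (fun δ : ℝ => (((1 + δ) * Q) ^ (1 / (1 + α))) ^ (-α)) 0 := by
        refine ContinuousAt.rpow_const (ContinuousAt.rpow_const (by fun_prop) (Or.inl ?_))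
          (Or.inl ?_)
        · simpa using hQ0.ne'
        · simpa using (Real.rpow_pos_of_pos hQ0 _).ne'
      have c2 : ContinuousAt (fun δ : ℝ => (((1 - δ) * Q) ^ (1 / (1 + α))) ^ (1 - α)) 0 := by
        refine ContinuousAt.rpow_const (ContinuousAt.rpow_const (by fun_prop) (Or.inl ?_))
          (Or.inl ?_)
        · simpa using hQ0.ne'
        · simpa using (Real.rpow_pos_of_pos hQ0 _).ne'
      have c3 : ContinuousAt (fun δ : ℝ =>
          Real.pi * ((1 - δ) * (C * (((1 + δ) * Q) ^ (1 / (1 + α))) ^ (-α))) ^ 2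
          + 2 * ((1 - δ) * (C * (((1 - δ) * Q) ^ (1 / (1 + α))) ^ (1 - α) / (1 - α)))) 0 := by
        fun_prop
      have h := c3.tendsto
      simpa [spiralContent, hQ] using h
    obtain ⟨δ, hδu, hδ0, hδ1⟩ := ((hlim.eventually (lt_mem_nhds hu)).and hδmem).exists
    have h1δ : 0 < 1 - δ := by linarith
    set A := ((1 - δ) * Q) ^ (1 / (1 + α)) with hA
    set B := ((1 + δ) * Q) ^ (1 / (1 + α)) with hB
    have hA0 : 0 < A := by positivity
    have hB0 : 0 < B := by positivity
    obtain ⟨a, ha⟩ := eventually_le_volume hα₀ hα₁ hC hf hder hfa hf'a hδ0 hδ1 hA0 hB0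
      (by rw [hA, one_div, Real.rpow_inv_rpow (by positivity) (by positivity)])
      (by rw [hB, one_div, Real.rpow_inv_rpow (by positivity) (by positivity)])
    have hL : Tendsto (fun X : ℝ => ENNReal.ofReal
        (Real.pi * ((1 - δ) * (C * (B + 2 * Real.pi * X⁻¹) ^ (-α))) ^ 2
          + 2 * ((1 - δ) * (C * ((A - 2 * Real.pi * X⁻¹) ^ (1 - α)
            - a ^ (1 - α) * X ^ (-(1 - α))) / (1 - α))))) atTop
        (𝓝 (ENNReal.ofReal (Real.pi * ((1 - δ) * (C * B ^ (-α))) ^ 2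
          + 2 * ((1 - δ) * (C * A ^ (1 - α) / (1 - α)))))) := by
      refine ENNReal.tendsto_ofReal ?_
      have t1 : Tendsto (fun X : ℝ => (B + 2 * Real.pi * X⁻¹) ^ (-α)) atTop (𝓝 (B ^ (-α))) := by
        have := (hinv.const_mul (2 * Real.pi)).const_add B
        rw [mul_zero, add_zero] at this
        exact this.rpow_const (Or.inl hB0.ne')
      have t2 : Tendsto (fun X : ℝ => (A - 2 * Real.pi * X⁻¹) ^ (1 - α)) atTop
          (𝓝 (A ^ (1 - α))) := by
        have := (hinv.const_mul (2 * Real.pi)).const_sub A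
        rw [mul_zero, sub_zero] at this
        exact this.rpow_const (Or.inl hA0.ne')
      have t3 := t2.sub (hpow.const_mul (a ^ (1 - α)))
      rw [mul_zero, sub_zero] at t3
      exact ((((t1.const_mul C).const_mul (1 - δ)).pow 2).const_mul Real.pi).add
        ((((t3.const_mul C).div_const (1 - α)).const_mul (1 - δ)).const_mul 2)
    filter_upwards [ha, hL.eventually (lt_mem_nhds hδu)] with X h1 h2
    exact h2.trans_le h1
  · have hlim : Tendsto (fun δ : ℝ => ENNReal.ofReal ((1 + δ) ^ 2 * spiralContent α C))
        (𝓝[>] 0) (𝓝 (ENNReal.ofReal (spiralContent α C))) := by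
      refine ENNReal.tendsto_ofReal (Tendsto.mono_left ?_ nhdsWithin_le_nhds)
      have h : ContinuousAt (fun δ : ℝ => (1 + δ) ^ 2 * spiralContent α C) 0 := by fun_prop
      simpa using h.tendsto
    obtain ⟨δ, hδu, hδ0, hδ1⟩ := ((hlim.eventually (gt_mem_nhds hu)).and hδmem).exists
    set A := Q ^ (1 / (1 + α)) with hA
    have hA0 : 0 < A := by positivity
    obtain ⟨K, hK⟩ := eventually_volume_le hα₀ hα₁ hC hf hder hf'c hfa hf'a hA0 hδ0 hδ1
    have hU : Tendsto (fun X : ℝ => ENNReal.ofReal (K * X ^ (-(1 - α)) +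
          (1 + δ) ^ 2 * (Real.pi * (C * A ^ (-α) + X⁻¹) ^ 2
            + 2 * (C * A ^ (1 - α) / (1 - α)) + 2 * A * X⁻¹))) atTop
        (𝓝 (ENNReal.ofReal ((1 + δ) ^ 2 * spiralContent α C))) := by
      refine ENNReal.tendsto_ofReal ?_
      have t := (hpow.const_mul K).add ((((((hinv.const_add (C * A ^ (-α))).pow 2).const_mul
        Real.pi).add_const (2 * (C * A ^ (1 - α) / (1 - α)))).add
          (hinv.const_mul (2 * A))).const_mul ((1 + δ) ^ 2))
      simpa [spiralContent, hA, hQ] using t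
    filter_upwards [hK, hU.eventually (gt_mem_nhds hδu)] with X h1 h2
    exact h1.trans_lt h2

/-- Spirals with `f φ ∼ C φ ^ (-α)`, together with first derivatives, have Minkowski content
`spiralContent α C` in dimension `2 / (1 + α)`. -/
lemma tendsto_volume_thickening_spiral {α C φ₀ : ℝ} {f f' : ℝ → ℝ}
    (hα₀ : 0 < α) (hα₁ : α < 1) (hC : 0 < C)
    (hder : ∀ φ, φ₀ ≤ φ → HasDerivWithinAt f (f' φ) (Set.Ici φ₀) φ)
    (hf'c : ContinuousOn f' (Set.Ici φ₀))
    (hfa : Tendsto (fun φ : ℝ => f φ / (C * φ ^ (-α))) atTop (𝓝 1))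
    (hf'a : Tendsto (fun φ : ℝ => f' φ / (-α * C * φ ^ (-α - 1))) atTop (𝓝 1)) :
    Tendsto (fun ε : ℝ => volume (Metric.thickening ε (spiral f φ₀))
      / ENNReal.ofReal (ε ^ (((2 : ℕ) : ℝ) - 2 / (1 + α)))) (𝓝[>] 0)
      (𝓝 (ENNReal.ofReal (spiralContent α C))) := by
  -- Extending `f` by a constant to the left makes it continuous on the whole line without changing
  -- the spiral.
  set F : ℝ → ℝ := fun φ => f (max φ₀ φ) with hF
  have hFf : ∀ φ, φ₀ ≤ φ → F φ = f φ := fun φ hφ => by simp [hF, max_eq_right hφ]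
  have hFc : Continuous F := by
    have hc : ContinuousOn f (Set.Ici φ₀) := fun φ hφ => (hder φ hφ).continuousWithinAt
    exact hc.comp_continuous (by fun_prop) fun φ => Set.mem_Ici.2 (le_max_left _ _)
  have hFder : ∀ φ, φ₀ ≤ φ → HasDerivWithinAt F (f' φ) (Set.Ici φ₀) φ := fun φ hφ =>
    (hder φ hφ).congr (fun x hx => hFf x hx) (hFf φ hφ)
  have hFa : Tendsto (fun φ : ℝ => F φ / (C * φ ^ (-α))) atTop (𝓝 1) := by
    refine hfa.congr' ?_
    filter_upwards [eventually_ge_atTop φ₀] with φ hφ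
    rw [hFf φ hφ]
  have hFs : spiral F φ₀ = spiral f φ₀ := by
    rw [spiral_eq_image, spiral_eq_image]
    exact Set.image_congr fun φ hφ => by rw [hFf φ hφ]
  have h := tendsto_inv_rpow_mul_volume hα₀ hα₁ hC hFc hFder hf'c hFa hf'a
  rw [hFs] at h
  have hX : Tendsto (fun ε : ℝ => ε ^ (-(1 / (1 + α)))) (𝓝[>] 0) atTop :=
    tendsto_rpow_neg_nhdsGT_zero (by rw [neg_lt_zero]; positivity)
  refine (h.comp hX).congr' ?_
  filter_upwards [self_mem_nhdsWithin] with ε hε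
  have hε0 : (0 : ℝ) < ε := hε
  have e1 : (ε ^ (-(1 / (1 + α)))) ^ (-(1 + α)) = ε := by
    rw [← Real.rpow_mul hε0.le]
    convert Real.rpow_one ε using 2
    field_simp
  have e2 : (ε ^ (-(1 / (1 + α)))) ^ (2 * α) = (ε ^ (((2 : ℕ) : ℝ) - 2 / (1 + α)))⁻¹ := by
    rw [← Real.rpow_mul hε0.le, ← Real.rpow_neg hε0.le]
    congr 1
    push_cast
    field_simp
    ring
  simp only [Function.comp_apply]
  rw [e1, e2, ENNReal.ofReal_inv_of_pos (Real.rpow_pos_of_pos hε0 _), ENNReal.div_eq_inv_mul, mul_comm]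

/-! ### From the limit to contents and box dimensions -/

lemma hasMinkowskiContent_of_tendsto {n : ℕ} {s : ℝ} {A : Set (EuclideanSpace ℝ (Fin n))}
    {m : ℝ≥0∞} (h : Tendsto (fun ε : ℝ => volume (Metric.thickening ε A)
      / ENNReal.ofReal (ε ^ ((n : ℝ) - s))) (𝓝[>] 0) (𝓝 m)) :
    HasMinkowskiContent s A m :=
  ⟨h.liminf_eq, h.limsup_eq⟩

/-- A set with positive finite Minkowski content in dimension `d` has box dimension `d`. -/
lemma hasBoxDim_of_tendsto {n : ℕ} {d : ℝ} (hd : 0 < d) {A : Set (EuclideanSpace ℝ (Fin n))}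
    {m : ℝ≥0∞} (hm0 : m ≠ 0) (hm : m ≠ ∞)
    (h : Tendsto (fun ε : ℝ => volume (Metric.thickening ε A)
      / ENNReal.ofReal (ε ^ ((n : ℝ) - d))) (𝓝[>] 0) (𝓝 m)) :
    HasBoxDim A d := by
  -- Passing from exponent `d` to `s` multiplies the quotient by `ε ^ (s - d)`, so the content drops
  -- to `0` above `d` and jumps to `∞` below it.
  have hratio : ∀ s, (fun ε : ℝ => volume (Metric.thickening ε A)
      / ENNReal.ofReal (ε ^ ((n : ℝ) - d)) * ENNReal.ofReal (ε ^ (s - d))) =ᶠ[𝓝[>] 0]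
      fun ε : ℝ => volume (Metric.thickening ε A) / ENNReal.ofReal (ε ^ ((n : ℝ) - s)) := by
    intro s
    filter_upwards [self_mem_nhdsWithin] with ε hε
    have hε0 : (0 : ℝ) < ε := hε
    rw [div_eq_mul_inv, div_eq_mul_inv, mul_assoc,
      ← ENNReal.ofReal_inv_of_pos (Real.rpow_pos_of_pos hε0 _),
      ← ENNReal.ofReal_inv_of_pos (Real.rpow_pos_of_pos hε0 _),
      ← ENNReal.ofReal_mul (by positivity), ← Real.rpow_neg hε0.le, ← Real.rpow_neg hε0.le,
      ← Real.rpow_add hε0]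
    congr 3
    ring
  have hgt : ∀ s, d < s → HasMinkowskiContent s A 0 := by
    intro s hs
    refine hasMinkowskiContent_of_tendsto (Tendsto.congr' (hratio s) ?_)
    have h1 : Tendsto (fun ε : ℝ => ENNReal.ofReal (ε ^ (s - d))) (𝓝[>] 0) (𝓝 0) := by
      have h2 : ContinuousAt (fun ε : ℝ => ε ^ (s - d)) 0 :=
        Real.continuousAt_rpow_const _ _ (Or.inr (by linarith))
      have h3 := ENNReal.tendsto_ofReal (h2.tendsto.mono_left
        (nhdsWithin_le_nhds (s := Set.Ioi 0)))
      rwa [Real.zero_rpow (by linarith), ENNReal.ofReal_zero] at h3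
    simpa using ENNReal.Tendsto.mul h (Or.inr ENNReal.zero_ne_top) h1 (Or.inr hm)
  have hlt : ∀ s, s < d → HasMinkowskiContent s A ∞ := by
    intro s hs
    refine hasMinkowskiContent_of_tendsto (Tendsto.congr' (hratio s) ?_)
    have h1 : Tendsto (fun ε : ℝ => ENNReal.ofReal (ε ^ (s - d))) (𝓝[>] 0) (𝓝 ∞) :=
      ENNReal.tendsto_ofReal_nhds_top.2 (tendsto_rpow_neg_nhdsGT_zero (by linarith))
    have h2 := ENNReal.Tendsto.mul h (Or.inl hm0) h1 (Or.inl ENNReal.top_ne_zero)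
    rwa [ENNReal.mul_top hm0] at h2
  have heq := hasMinkowskiContent_of_tendsto h
  constructor
  · have hset : {s : ℝ | 0 < s ∧ lowerMinkowskiContent s A = 0} = Set.Ioi d := by
      ext s
      refine ⟨fun ⟨_, h0⟩ => ?_, fun hs => ⟨hd.trans hs, (hgt s hs).1⟩⟩
      rcases lt_trichotomy s d with hs | rfl | hs
      · exact absurd ((hlt s hs).1.symm.trans h0) ENNReal.top_ne_zero
      · exact absurd (heq.1.symm.trans h0) hm0
      · exact hs
    rw [lowerBoxDim, hset, csInf_Ioi]
  · have hset : {s : ℝ | 0 < s ∧ upperMinkowskiContent s A = 0} = Set.Ioi d := by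
      ext s
      refine ⟨fun ⟨_, h0⟩ => ?_, fun hs => ⟨hd.trans hs, (hgt s hs).2⟩⟩
      rcases lt_trichotomy s d with hs | rfl | hs
      · exact absurd ((hlt s hs).2.symm.trans h0) ENNReal.top_ne_zero
      · exact absurd (heq.2.symm.trans h0) hm0
      · exact hs
    rw [upperBoxDim, hset, csInf_Ioi]

theorem proposition2p26 (α : ℝ) (hα₀ : 0 < α) (hα₁ : α < 1)
    (φ₀ : ℝ) (hφ₀ : 0 < φ₀) (C : ℝ) (hC : 0 < C) (M : ℝ) (hM : 0 < M)
    (f f' f'' : ℝ → ℝ)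
    (hpos : ∀ φ : ℝ, φ₀ ≤ φ → 0 < f φ)
    (hf' : ∀ φ : ℝ, φ₀ ≤ φ → HasDerivWithinAt f (f' φ) (Set.Ici φ₀) φ)
    (hf'' : ∀ φ : ℝ, φ₀ ≤ φ → HasDerivWithinAt f' (f'' φ) (Set.Ici φ₀) φ)
    (hf_asymp : Tendsto (fun φ : ℝ => f φ / (C * φ ^ (-α))) atTop (𝓝 1))
    (hf'_asymp : Tendsto (fun φ : ℝ => f' φ / (-α * C * φ ^ (-α - 1))) atTop (𝓝 1))
    (hf''_bound : ∀ φ : ℝ, φ₀ ≤ φ → |f'' φ| ≤ M * φ ^ (-α)) :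
    HasBoxDim (spiral f φ₀) (2 / (1 + α)) ∧
    HasBoxDim (spiral (fun φ => f φ / (f φ ^ 2 + 1)) φ₀) (2 / (1 + α)) ∧
    ∃ m : ℝ≥0∞, 0 < m ∧ m < ∞ ∧
      HasMinkowskiContent (2 / (1 + α)) (spiral f φ₀) m ∧
      HasMinkowskiContent (2 / (1 + α)) (spiral (fun φ => f φ / (f φ ^ 2 + 1)) φ₀) m := by
  have hfc : ContinuousOn f (Set.Ici φ₀) := fun φ hφ => (hf' φ hφ).continuousWithinAt
  -- Differentiability of `f'` enters through its continuity, which bounds `f'` on the outer arc.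
  have hf'c : ContinuousOn f' (Set.Ici φ₀) := fun φ hφ => (hf'' φ hφ).continuousWithinAt
  have hne : ∀ φ, f φ ^ 2 + 1 ≠ 0 := fun φ => by positivity
  have h0 : Tendsto f atTop (𝓝 0) := tendsto_zero_of_power_asymp hα₀ hC hf_asymp
  have hΓ := tendsto_volume_thickening_spiral hα₀ hα₁ hC hf' hf'c hf_asymp hf'_asymp
  -- The factors `1 / (f ^ 2 + 1)` and `(1 - f ^ 2) / (f ^ 2 + 1) ^ 2` relating the new function and
  -- derivative to the old tend to `1`, so the same `α` and `C` apply.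
  have hΓ' := tendsto_volume_thickening_spiral (f := fun φ => f φ / (f φ ^ 2 + 1))
    (f' := fun φ => f' φ * ((1 - f φ ^ 2) / (f φ ^ 2 + 1) ^ 2)) (φ₀ := φ₀) hα₀ hα₁ hC
    (fun φ hφ => by
      refine ((hf' φ hφ).div (((hf' φ hφ).pow 2).add_const 1) (hne φ)).congr_deriv ?_
      simp only [Pi.pow_apply]
      rw [← mul_div_assoc]
      congr 1
      push_cast
      ring)
    (hf'c.mul ((continuousOn_const.sub (hfc.pow 2)).div
      (((hfc.pow 2).add continuousOn_const).pow 2) fun φ _ => pow_ne_zero 2 (hne φ)))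
    (by
      have h := hf_asymp.div ((h0.pow 2).add_const 1) (by norm_num)
      norm_num at h
      exact h.congr fun φ => div_right_comm _ _ _)
    (by
      have h := hf'_asymp.mul (((h0.pow 2).const_sub 1).div (((h0.pow 2).add_const 1).pow 2)
        (by norm_num))
      norm_num at h
      refine h.congr fun φ => ?_
      rw [neg_mul, neg_mul, mul_div_right_comm])
  have hm := ENNReal.ofReal_pos.2 (spiralContent_pos hα₀ hα₁ hC)
  have hd : 0 < 2 / (1 + α) := by positivity
  exact ⟨hasBoxDim_of_tendsto hd hm.ne' ENNReal.ofReal_ne_top hΓ,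
    hasBoxDim_of_tendsto hd hm.ne' ENNReal.ofReal_ne_top hΓ', _, hm, ENNReal.ofReal_lt_top,
    hasMinkowskiContent_of_tendsto hΓ, hasMinkowskiContent_of_tendsto hΓ'⟩
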